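/- **Setting.** Let $M$ be a smooth manifold and $n\ge 1$. Let $(M,\omega)$ be pre-$n$-plectic, that is, $\omega\in\Omega^{n+1}(M)$ is closed. A form $H\in\Omega^{n-1}(M)$ is Hamiltonian, written $H\in\Omega^{n-1}_{\mathrm{Ham}}(M)$, if there is a vector field $v_H$ (a Hamiltonian vector field of $H$) with $dH=-\iota_{v_H}\omega$. Put $\varsigma(k)=-(-1)^{k(k+1)/2}$. Let $\mathfrak g$ be a real Lie algebra and let $v:\mathfrak g\to\mathfrak X(M)$, $x\mapsto v_x$, be a multisymplectic infinitesimal action, i.e. a Lie algebra homomorphism with $\mathcal L_{v_x}\omega=0$ for all $x$. For $p=x_1\wedge\dots\wedge x_k\in\Lambda^k\mathfrak g$ set $\iota(v_p)=\iota_{v_{x_k}}\cdots\iota_{v_{x_1}}$, extended linearly to all $p\in\Lambda^k\mathfrak g$. Let $$\partial_k:\Lambda^k\mathfrak g\to\Lambda^{k-1}\mathfrak g,\qquad \partial_k(x_1\wedge\dots\wedge x_k)=\sum_{1\le i<j\le k}(-1)^{i+j}[x_i,x_j]\wedge x_1\wedge\cdots\wedge\widehat{x_i}\wedge\cdots\wedge\widehat{x_j}\wedge\cdots\wedge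 x_k ,$$ be the Lie algebra homology differential, and $Z_k(\mathfrak g)=\ker\partial_k$. A homotopy co-momentum map for $v$ is a family $(f)$ of linear maps $f_k:\Lambda^k\mathfrak g\to\Omega^{n-k}(M)$, $1\le k\le n$, with $f_1(\mathfrak g)\subset\Omega^{n-1}_{\mathrm{Ham}}(M)$, with $d f_1(x)=-\iota_{v_x}\omega$ for all $x\in\mathfrak g$, and with $$-f_{k-1}(\partial_k p)=d f_k(p)+\varsigma(k)\,\iota(v_p)\omega\qquad\text{for all } 1\le k\le n+1,\ p\in\Lambda^k\mathfrak g,$$ where $f_0=0$ and $f_{n+1}=0$. **Proposition.** Let $(M,\omega)$ be a pre-$n$-plectic manifold, $H\in\Omega^{n-1}_{\mathrm{Ham}}(M)$, and $v_H$ any Hamiltonian vector field of $H$. Let $(f)$ be a homotopy co-momentum map for a multisymplectic infinitesimal action $v$ of $\mathfrak g$ which strictly preserves $H$, i.e. $\mathcal L_{v_x}H=0$ for all $x\in\mathfrak g$. Then for every $1\le k\le n$ and every $p\in Z_k(\mathfrak g)$ the form $f_k(p)$ is globally conserved by $v_H$, i.e. $\mathcal L_{v_H}f_k(p)$ is exact.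 Explicitly, $$\mathcal L_{v_H}f_k(p)=d\bigl(\iota_{v_H}f_k(p)+\varsigma(k)\,\iota(v_p)H\bigr).$$ (Forms of negative degree are zero; so for $k=n$ this says $\mathcal L_{v_H}f_n(p)=0$.) -/

import Mathlib

open scoped Manifold

noncomputable section

namespace Multisymplectic

section LieHomology

open ExteriorAlgebra

/-- Removing entry `j + 1` and then the head is the same as removing entry `j` of the tail. -/
lemma vecTail_succ_removeNth {α : Type*} {k : ℕ} (j : Fin (k + 1)) (y : Fin (k + 2) → α) :
    Matrix.vecTail (j.succ.removeNth y) = j.removeNth (Matrix.vecTail y) := by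
  ext i
  simp [Fin.removeNth, Matrix.vecTail]

variable (𝔤 : Type*) [LieRing 𝔤] [LieAlgebra ℝ 𝔤]

/-- Recursion step for `adExt`. -/
def adStep : 𝔤 →ₗ[ℝ] ExteriorAlgebra ℝ 𝔤 × (𝔤 →ₗ[ℝ] ExteriorAlgebra ℝ 𝔤) →ₗ[ℝ]
    (𝔤 →ₗ[ℝ] ExteriorAlgebra ℝ 𝔤) :=
  LinearMap.mk₂ ℝ
    (fun y qn =>
      { toFun := fun x => ι ℝ ⁅x, y⁆ * qn.1 + ι ℝ y * qn.2 x
        map_add' := fun x x' => by simp [add_mul, mul_add]; abel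
        map_smul' := fun c x => by simp })
    (fun y y' qn => by ext x; simp [add_mul]; abel)
    (fun c y qn => by ext x; simp)
    (fun y qn qn' => by ext x; simp [mul_add]; abel)
    (fun c y qn => by ext x; simp)

/-- `adExt 𝔤 q x = [x, q]`: the extension of `ad x` to a derivation of the exterior algebra, given by
`[x, 1] = 0` and `[x, y ∧ q] = [x, y] ∧ q + y ∧ [x, q]`. -/
def adExt : ExteriorAlgebra ℝ 𝔤 →ₗ[ℝ] 𝔤 →ₗ[ℝ] ExteriorAlgebra ℝ 𝔤 :=
  CliffordAlgebra.foldr' (0 : QuadraticForm ℝ 𝔤) (adStep 𝔤)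
    (fun y q n => by
      ext x
      have h := ι_add_mul_swap (R := ℝ) ⁅x, y⁆ y
      have h2 := ι_sq_zero (R := ℝ) y
      change ι ℝ ⁅x, y⁆ * (ι ℝ y * q) + ι ℝ y * (ι ℝ ⁅x, y⁆ * q + ι ℝ y * n x) = _
      rw [mul_add, ← mul_assoc, ← mul_assoc, ← mul_assoc, h2, ← add_assoc, ← add_mul, h]
      simp)
    0

lemma adExt_one (x : 𝔤) : adExt 𝔤 1 x = 0 := by
  have := CliffordAlgebra.foldr'_algebraMap (0 : QuadraticForm ℝ 𝔤) (adStep 𝔤) (by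
      intro y q n
      ext x
      have h := ι_add_mul_swap (R := ℝ) ⁅x, y⁆ y
      have h2 := ι_sq_zero (R := ℝ) y
      change ι ℝ ⁅x, y⁆ * (ι ℝ y * q) + ι ℝ y * (ι ℝ ⁅x, y⁆ * q + ι ℝ y * n x) = _
      rw [mul_add, ← mul_assoc, ← mul_assoc, ← mul_assoc, h2, ← add_assoc, ← add_mul, h]
      simp) 0 1
  simpa [adExt] using congrArg (· x) this

lemma adExt_ι_mul (x y : 𝔤) (q : ExteriorAlgebra ℝ 𝔤) :
    adExt 𝔤 (ι ℝ y * q) x = ι ℝ ⁅x, y⁆ * q + ι ℝ y * adExt 𝔤 q x :=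
  congrArg (· x) (CliffordAlgebra.foldr'_ι_mul (0 : QuadraticForm ℝ 𝔤) (adStep 𝔤) _ 0 y q)

/-- Recursion step for `lieDiff`. -/
def lieDiffStep : 𝔤 →ₗ[ℝ] ExteriorAlgebra ℝ 𝔤 × ExteriorAlgebra ℝ 𝔤 →ₗ[ℝ] ExteriorAlgebra ℝ 𝔤 :=
  LinearMap.mk₂ ℝ (fun x qn => - (ι ℝ x * qn.2) - adExt 𝔤 qn.1 x)
    (fun y y' qn => by simp [add_mul]; abel)
    (fun c y qn => by simp [smul_sub])
    (fun y qn qn' => by simp [mul_add]; abel)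
    (fun c y qn => by simp [smul_sub])

/-- The Lie algebra homology differential on the whole exterior algebra, constructed by
`∂ 1 = 0` and `∂ (x ∧ q) = - x ∧ ∂ q - [x, q]`. Its usual closed formula is `lieDiff_ιMulti`. -/
def lieDiff : ExteriorAlgebra ℝ 𝔤 →ₗ[ℝ] ExteriorAlgebra ℝ 𝔤 :=
  CliffordAlgebra.foldr' (0 : QuadraticForm ℝ 𝔤) (lieDiffStep 𝔤)
    (fun x q n => by
      have h2 := ι_sq_zero (R := ℝ) x
      change - (ι ℝ x * (- (ι ℝ x * n) - adExt 𝔤 q x)) - adExt 𝔤 (ι ℝ x * q) x = _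
      rw [adExt_ι_mul, mul_sub, mul_neg, ← mul_assoc, h2]
      simp)
    0

lemma lieDiff_one : lieDiff 𝔤 1 = 0 := by
  have := CliffordAlgebra.foldr'_algebraMap (0 : QuadraticForm ℝ 𝔤) (lieDiffStep 𝔤) (by
      intro x q n
      have h2 := ι_sq_zero (R := ℝ) x
      change - (ι ℝ x * (- (ι ℝ x * n) - adExt 𝔤 q x)) - adExt 𝔤 (ι ℝ x * q) x = _
      rw [adExt_ι_mul, mul_sub, mul_neg, ← mul_assoc, h2]
      simp) 0 1
  simpa [lieDiff] using this

lemma lieDiff_ι_mul (x : 𝔤) (q : ExteriorAlgebra ℝ 𝔤) :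
    lieDiff 𝔤 (ι ℝ x * q) = - (ι ℝ x * lieDiff 𝔤 q) - adExt 𝔤 q x :=
  CliffordAlgebra.foldr'_ι_mul (0 : QuadraticForm ℝ 𝔤) (lieDiffStep 𝔤) _ 0 x q

/-- `θ_x (y_0 ∧ ⋯ ∧ y_{k}) = ∑ j (-1)^j [x,y_j] ∧ (remove j)`. -/
lemma adExt_ιMulti (k : ℕ) (x : 𝔤) (y : Fin (k + 1) → 𝔤) :
    adExt 𝔤 (ιMulti ℝ (k + 1) y) x =
      ∑ j : Fin (k + 1), (-1 : ℝ) ^ (j : ℕ) • (ι ℝ ⁅x, y j⁆ * ιMulti ℝ k (j.removeNth y)) := by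
  induction k with
  | zero =>
    rw [ιMulti_succ_apply, adExt_ι_mul]
    simp [adExt_one]
  | succ k ih =>
    rw [ιMulti_succ_apply, adExt_ι_mul, ih, Finset.mul_sum, Fin.sum_univ_succ (n := k + 1)]
    congr 1
    · simp; rfl
    · refine Finset.sum_congr rfl fun j _ => ?_
      have h := ι_add_mul_swap (R := ℝ) (y 0) ⁅x, y j.succ⁆
      have h' : ι ℝ (y 0) * ι ℝ ⁅x, y j.succ⁆ = - (ι ℝ ⁅x, y j.succ⁆ * ι ℝ (y 0)) :=
        eq_neg_of_add_eq_zero_left h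
      rw [ιMulti_succ_apply (v := j.succ.removeNth y), mul_smul_comm, ← mul_assoc, ← mul_assoc]
      change _ • (ι ℝ (y 0) * ι ℝ ⁅x, y j.succ⁆ * _) = _
      rw [h', Fin.val_succ, pow_succ]
      simp only [neg_mul, smul_neg, mul_neg, mul_one, neg_smul]
      rw [vecTail_succ_removeNth]
      rfl

/-- The defining formula of the Lie algebra homology differential,
`∂ (x_0 ∧ ⋯ ∧ x_{k+1}) = ∑_{a < b} (-1)^(a+b) [x_a, x_b] ∧ x_0 ∧ ⋯ x̂_a ⋯ x̂_b ⋯ ∧ x_{k+1}`;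
the pairs `a < b` are written as `a = i`, `b = j + 1` with `i ≤ j`. -/
theorem lieDiff_ιMulti (k : ℕ) (x : Fin (k + 2) → 𝔤) :
    lieDiff 𝔤 (ιMulti ℝ (k + 2) x) =
      ∑ i : Fin (k + 1), ∑ j ≥ i, (-1 : ℝ) ^ (i + (j + 1) : ℕ) •
        (ι ℝ ⁅x i.castSucc, x j.succ⁆ *
          ιMulti ℝ k (j.removeNth (i.castSucc.removeNth x))) := by
  induction k with
  | zero =>
    rw [ιMulti_succ_apply, lieDiff_ι_mul, adExt_ιMulti, ιMulti_succ_apply, lieDiff_ι_mul]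
    simp [lieDiff_one, adExt_one]
    rfl
  | succ k ih =>
    rw [ιMulti_succ_apply, lieDiff_ι_mul, adExt_ιMulti, ih]
    conv_rhs => rw [Fin.sum_univ_succ (n := k + 1), add_comm]
    simp only [← Finset.filter_le_eq_Ici, Finset.sum_filter]
    rw [sub_eq_add_neg, Finset.mul_sum, ← Finset.sum_neg_distrib, ← Finset.sum_neg_distrib]
    congr 1
    · refine Finset.sum_congr rfl fun i _ => ?_
      rw [Fin.sum_univ_succ (n := k + 1), if_neg (by simp), zero_add, Finset.mul_sum,
        ← Finset.sum_neg_distrib]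
      refine Finset.sum_congr rfl fun j _ => ?_
      by_cases hij : i ≤ j
      · rw [if_pos hij, if_pos (by simpa using hij)]
        have h := ι_add_mul_swap (R := ℝ) (x 0) ⁅x i.castSucc.succ, x j.succ.succ⁆
        have h' := eq_neg_of_add_eq_zero_left h
        rw [ιMulti_succ_apply (v := (j.succ.removeNth (i.succ.castSucc.removeNth x) : Fin (k + 1) → 𝔤)),
          mul_smul_comm, ← mul_assoc, ← mul_assoc]
        change - (_ • (ι ℝ (x 0) * ι ℝ ⁅x i.castSucc.succ, x j.succ.succ⁆ * _)) = _
        rw [h', Fin.val_succ, Fin.val_succ,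
          show (i : ℕ) + 1 + ((j : ℕ) + 1 + 1) = (i : ℕ) + ((j : ℕ) + 1) + 2 by ring,
          pow_add (-1 : ℝ) ((i : ℕ) + ((j : ℕ) + 1)) 2, neg_one_sq, mul_one]
        simp only [neg_mul, smul_neg, neg_neg]
        rw [vecTail_succ_removeNth, ← Fin.succ_castSucc, vecTail_succ_removeNth]
        rfl
      · rw [if_neg hij, if_neg (by simpa using hij)]
        simp
    · refine Finset.sum_congr rfl fun j _ => ?_
      rw [if_pos (Fin.zero_le _), Fin.val_zero, zero_add, pow_succ]
      simp only [mul_neg, mul_one, neg_smul]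
      rfl

lemma lieDiff_mem (k : ℕ) {p : ExteriorAlgebra ℝ 𝔤} (hp : p ∈ ⋀[ℝ]^k 𝔤) :
    lieDiff 𝔤 p ∈ ⋀[ℝ]^(k - 1) 𝔤 := by
  rw [← ιMulti_span_fixedDegree] at hp
  induction hp using Submodule.span_induction with
  | zero => simp
  | add p q _ _ hp hq => rw [map_add]; exact add_mem hp hq
  | smul c p _ hp => rw [map_smul]; exact Submodule.smul_mem _ c hp
  | mem p hp =>
    obtain ⟨x, rfl⟩ := hp
    match k, x with
    | 0, x => simp [lieDiff_one]
    | 1, x =>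
      rw [ιMulti_succ_apply, lieDiff_ι_mul]
      simp [lieDiff_one, adExt_one]
    | k + 2, x =>
      rw [lieDiff_ιMulti]
      refine Submodule.sum_mem _ fun i _ => Submodule.sum_mem _ fun j _ =>
        Submodule.smul_mem _ _ ?_
      have h := ιMulti_range (M := 𝔤) ℝ (k + 1) ⟨Fin.cons ⁅x i.castSucc, x j.succ⁆
        (j.removeNth (i.castSucc.removeNth x)), rfl⟩
      rw [ιMulti_succ_apply] at h
      exact h

/-- The Lie algebra homology differential `∂_k : Λ^k 𝔤 → Λ^(k-1) 𝔤` (and `∂_0 = 0`). -/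
def lieBoundary (k : ℕ) : ⋀[ℝ]^k 𝔤 →ₗ[ℝ] ⋀[ℝ]^(k - 1) 𝔤 :=
  (lieDiff 𝔤).restrict fun _ hp => lieDiff_mem 𝔤 k hp

/-- The space `Z_k(𝔤) = ker ∂_k` of Lie algebra homology cycles. -/
def lieCycles (k : ℕ) : Submodule ℝ (⋀[ℝ]^k 𝔤) :=
  LinearMap.ker (lieBoundary 𝔤 k)

end LieHomology

section Forms

variable (E : Type*) [NormedAddCommGroup E] [NormedSpace ℝ E]
  (M : Type*) [TopologicalSpace M] [ChartedSpace E M]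

/-- (Not necessarily smooth) vector fields on the manifold `M` modelled on `E`. -/
abbrev VField := ∀ x : M, TangentSpace 𝓘(ℝ, E) x

/-- (Not necessarily smooth) inhomogeneous differential forms on `M`; the component of degree `k`
assigns to a point `x` an alternating `k`-form on `T_x M`. In Mathlib `TangentSpace 𝓘(ℝ, E) x` is by
definition `E` (through the preferred chart at `x`), and this is how the fibre appears here.
Working with all degrees at once gives `Ω^j(M) = 0` for `j < 0` its usual meaning. -/
abbrev Form := ∀ k : ℕ, M → E [⋀^Fin k]→L[ℝ] ℝ

variable {E M}

/-- Smoothness of a vector field, as a section of the tangent bundle. -/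
def VField.IsSmooth [IsManifold 𝓘(ℝ, E) (⊤ : ℕ∞) M] (V : VField E M) : Prop :=
  ContMDiff 𝓘(ℝ, E) 𝓘(ℝ, E).tangent (⊤ : ℕ∞) (fun x => (⟨x, V x⟩ : TangentBundle 𝓘(ℝ, E) M))

/-- The expression of a `k`-form in the chart at `x₀`: its pullback under the inverse chart. -/
def chartForm {k : ℕ} (x₀ : M) (α : M → E [⋀^Fin k]→L[ℝ] ℝ) (y : E) : E [⋀^Fin k]→L[ℝ] ℝ :=
  (α ((extChartAt 𝓘(ℝ, E) x₀).symm y)).compContinuousLinearMap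
    (mfderiv 𝓘(ℝ, E) 𝓘(ℝ, E) (extChartAt 𝓘(ℝ, E) x₀).symm y)

/-- The expression of a vector field in the chart at `x₀`. -/
def chartField (x₀ : M) (V : VField E M) : E → E :=
  VectorField.mpullback 𝓘(ℝ, E) 𝓘(ℝ, E) (extChartAt 𝓘(ℝ, E) x₀).symm V

/-- The value at `x₀` of the pullback to `M`, by the chart at `x₀`, of a form on `E`. -/
def pullChart {k : ℕ} (x₀ : M) (β : E → E [⋀^Fin k]→L[ℝ] ℝ) : E [⋀^Fin k]→L[ℝ] ℝ :=
  (β (extChartAt 𝓘(ℝ, E) x₀ x₀)).compContinuousLinearMap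
    (mfderiv 𝓘(ℝ, E) 𝓘(ℝ, E) (extChartAt 𝓘(ℝ, E) x₀) x₀)

/-- Smoothness of an inhomogeneous form: every component is smooth in charts. -/
def Form.IsSmooth (α : Form E M) : Prop :=
  ∀ (k : ℕ) (x₀ : M), ContDiffOn ℝ (⊤ : ℕ∞) (chartForm x₀ (α k)) (extChartAt 𝓘(ℝ, E) x₀).target

/-- `α ∈ Ω^k(M)`: a smooth form which is homogeneous of degree `k`. -/
structure IsKForm (k : ℕ) (α : Form E M) : Prop where
  smooth : α.IsSmooth
  homogeneous : ∀ m, m ≠ k → α m = 0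

/-- The exterior derivative on a manifold, computed in charts. -/
def d (α : Form E M) : Form E M
  | 0 => 0
  | k + 1 => fun x => pullChart x (extDeriv (chartForm x (α k)))

/-- The Lie derivative of a `k`-form `β` on `E` along a vector field `V`,
`(L_V β)_y (w_1, …, w_k) = (D_V β)_y (w_1, …, w_k) + ∑_i β_y (w_1, …, DV_y w_i, …, w_k)`. -/
def lieDerivModel {k : ℕ} (V : E → E) (β : E → E [⋀^Fin k]→L[ℝ] ℝ) (y : E) :
    E [⋀^Fin k]→L[ℝ] ℝ :=
  fderiv ℝ β y (V y) +
    (β y).fderivCompContinuousLinearMap (ContinuousLinearMap.id ℝ E) (fderiv ℝ V y)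

/-- The Lie derivative of a form along a vector field on a manifold, computed in charts. -/
def lieDeriv (V : VField E M) (α : Form E M) : Form E M :=
  fun k x => pullChart x (lieDerivModel (chartField x V) (chartForm x (α k)))

/-- The contraction `ι_V α = α (V, ·, …, ·)`. -/
def contract (V : VField E M) : Module.End ℝ (Form E M) where
  toFun α := fun k x => (α (k + 1) x).curryLeft (V x)
  map_add' α β := by ext; rfl
  map_smul' c α := by ext; rfl

/-- `α` is exact: it is `dβ` for a smooth form `β`. -/
def IsExact (α : Form E M) : Prop :=
  ∃ β : Form E M, β.IsSmooth ∧ α = d β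

/-- `α` is a globally conserved quantity for `V`: the form `L_V α` is exact. -/
def IsGloballyConserved (V : VField E M) (α : Form E M) : Prop :=
  IsExact (lieDeriv V α)

end Forms

section Actions

variable {E : Type*} [NormedAddCommGroup E] [NormedSpace ℝ E]
  {M : Type*} [TopologicalSpace M] [ChartedSpace E M]
  {𝔤 : Type*} [LieRing 𝔤] [LieAlgebra ℝ 𝔤]

/-- The map `x ↦ ι_{v_x}`, with values in the opposite of the algebra of operators on forms. -/
def contractHom (v : 𝔤 →ₗ[ℝ] VField E M) : 𝔤 →ₗ[ℝ] (Module.End ℝ (Form E M))ᵐᵒᵖ where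
  toFun x := MulOpposite.op (contract (v x))
  map_add' x y := by
    apply MulOpposite.unop_injective
    apply LinearMap.ext
    intro α
    funext k y'
    change (α (k + 1) y').curryLeft (v (x + y) y') = _
    rw [map_add]
    exact ((α (k + 1) y').curryLeft).map_add (v x y') (v y y')
  map_smul' c x := by
    apply MulOpposite.unop_injective
    apply LinearMap.ext
    intro α
    funext k y'
    change (α (k + 1) y').curryLeft (v (c • x) y') = _
    rw [map_smul]
    exact ((α (k + 1) y').curryLeft).map_smul c (v x y')

lemma contractHom_sq (v : 𝔤 →ₗ[ℝ] VField E M) (x : 𝔤) :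
    contractHom v x * contractHom v x = 0 := by
  apply MulOpposite.unop_injective
  apply LinearMap.ext
  intro α
  funext k y
  exact (α (k + 2) y).curryLeft_same _

/-- The contraction `ι(v_p)` for `p ∈ Λ𝔤`: linear in `p`, with
`ι(v_p) = ι_{v_{x_k}} ∘ ⋯ ∘ ι_{v_{x_1}}` for `p = x_1 ∧ ⋯ ∧ x_k`; see `contractMulti_ιMulti`. -/
def contractMulti (v : 𝔤 →ₗ[ℝ] VField E M) (p : ExteriorAlgebra ℝ 𝔤) :
    Module.End ℝ (Form E M) :=
  MulOpposite.unop (ExteriorAlgebra.lift ℝ ⟨contractHom v, contractHom_sq v⟩ p)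

lemma contractMulti_ιMulti (v : 𝔤 →ₗ[ℝ] VField E M) {k : ℕ} (x : Fin (k + 1) → 𝔤) (α : Form E M) :
    contractMulti v (ExteriorAlgebra.ιMulti ℝ (k + 1) x) α =
      contractMulti v (ExteriorAlgebra.ιMulti ℝ k (fun i => x i.succ)) (contract (v (x 0)) α) := by
  rw [ExteriorAlgebra.ιMulti_succ_apply, contractMulti, map_mul, ExteriorAlgebra.lift_ι_apply]
  rfl

/-- The sign `ς(k) = -(-1)^(k(k+1)/2)`. -/
def varsigma (k : ℕ) : ℝ := -(-1) ^ (k * (k + 1) / 2)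

/-- `(M, ω)` is pre-`n`-plectic: `ω` is a closed `(n+1)`-form. -/
structure IsPrePlectic (n : ℕ) (ω : Form E M) : Prop where
  form : IsKForm (n + 1) ω
  closed : d ω = 0

variable [IsManifold 𝓘(ℝ, E) (⊤ : ℕ∞) M]

/-- `V` is a Hamiltonian vector field for `α`: it is smooth and `dα = - ι_V ω`. -/
structure IsHamiltonianField (ω α : Form E M) (V : VField E M) : Prop where
  smooth : V.IsSmooth
  eq : d α = - contract V ω

/-- `α ∈ Ω^{n-1}_Ham(M)`: an `(n-1)`-form with a Hamiltonian vector field. -/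
structure IsHamiltonianForm (n : ℕ) (ω α : Form E M) : Prop where
  form : IsKForm (n - 1) α
  exists_field : ∃ V : VField E M, IsHamiltonianField ω α V

/-- A multisymplectic infinitesimal action: a Lie algebra homomorphism from `𝔤` to the smooth vector
fields, with values in those that preserve `ω`. -/
structure IsMultisymplecticAction (ω : Form E M) (v : 𝔤 →ₗ[ℝ] VField E M) : Prop where
  smooth : ∀ x, (v x).IsSmooth
  map_lie : ∀ x y, v ⁅x, y⁆ = VectorField.mlieBracket 𝓘(ℝ, E) (v x) (v y)
  preserves : ∀ x, lieDeriv (v x) ω = 0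

/-- The action strictly preserves `H`. -/
def IsStrictlyPreserving (v : 𝔤 →ₗ[ℝ] VField E M) (H : Form E M) : Prop :=
  ∀ x, lieDeriv (v x) H = 0

/-- An `L_∞`-morphism from `𝔤` to the Lie `n`-algebra of observables of `(M, ω)`, with components
`f_k : Λ^k 𝔤 → Ω^{n-k}(M)` for `1 ≤ k ≤ n`; the components outside this range are zero. -/
structure IsLInftyMorphism (n : ℕ) (ω : Form E M) (v : 𝔤 →ₗ[ℝ] VField E M)
    (f : ∀ k : ℕ, ⋀[ℝ]^k 𝔤 →ₗ[ℝ] Form E M) : Prop where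
  form : ∀ k, 1 ≤ k → k ≤ n → ∀ p, IsKForm (n - k) (f k p)
  zero : f 0 = 0
  eq_zero_of_lt : ∀ k, n < k → f k = 0
  hamiltonian : ∀ p, IsHamiltonianForm n ω (f 1 p)
  eq : ∀ k, 1 ≤ k → k ≤ n + 1 → ∀ p : ⋀[ℝ]^k 𝔤,
    - f (k - 1) (lieBoundary 𝔤 k p) = d (f k p) + varsigma k • contractMulti v p ω

/-- A homotopy co-momentum map for the action `v` on `(M, ω)`. -/
structure IsComomentumMap (n : ℕ) (ω : Form E M) (v : 𝔤 →ₗ[ℝ] VField E M)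
    (f : ∀ k : ℕ, ⋀[ℝ]^k 𝔤 →ₗ[ℝ] Form E M) : Prop extends IsLInftyMorphism n ω v f where
  moment : ∀ x : 𝔤, d (f 1 (exteriorPower.ιMulti ℝ 1 (fun _ => x))) = - contract (v x) ω

end Actions

end Multisymplectic

end

/-! Cartan's formula gives `L_{vH} f_k(p) = d ι_{vH} f_k(p) + ι_{vH} d f_k(p)`, so the claim is that
`ι_{vH} d f_k(p)` equals `ς(k) d ι(v_p)H`. Since `∂p = 0`, the co-momentum equation reads `d f_k(p)
= -ς(k) ι(v_p)ω`. Moving `ι_{vH}` past `k` contractions and using `dH = -ι_{vH}ω` turns the first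
form into `ς(k)(-1)^k ι(v_p) dH`. For the second, `d_contractMulti` gives `d ι(v_p)H = (-1)^k
(ι(v_p) dH + ι(v_{∂p})H)`, whose last term vanishes on cycles.

The formula `d_contractMulti` is proved by induction on degree: Cartan's formula for `v_x` is
applied to `ι(v_q)α`, where `L_{v_x}α = 0` leaves only `ι(v_[x,q])α`, and the result is matched with
`∂(x ∧ q) = -x ∧ ∂q - [x, q]`. It rests on two identities, `L_V = dι_V + ι_V d` and `[L_V, ι_W] =
ι_[V,W]`. Both are computed on `E` and transported pointwise: at `x` only the preferred chart at `x`
is used, so independence of the chart never arises. -/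

namespace Multisymplectic

/-! ### Cartan calculus on a normed space. -/

section Model

variable {E : Type*} [NormedAddCommGroup E] [NormedSpace ℝ E] {k : ℕ}

/-- Product rule for the contraction of a form by a vector field on a normed space. -/
lemma hasFDerivAt_curryLeft {V : E → E} {β : E → E [⋀^Fin (k + 1)]→L[ℝ] ℝ} {y : E}
    (hβ : DifferentiableAt ℝ β y) (hV : DifferentiableAt ℝ V y) :
    HasFDerivAt (fun z => (β z).curryLeft (V z))
      ((β y).curryLeft ∘L fderiv ℝ V y +
        (ContinuousAlternatingMap.curryLeftLI.toContinuousLinearMap ∘L fderiv ℝ β y).flip (V y))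
      y := by
  let L : (E [⋀^Fin (k + 1)]→L[ℝ] ℝ) →L[ℝ] E →L[ℝ] E [⋀^Fin k]→L[ℝ] ℝ :=
    ContinuousAlternatingMap.curryLeftLI.toContinuousLinearMap
  have hL : HasFDerivAt L L (β y) := by apply ContinuousLinearMap.hasFDerivAt
  have hc := HasFDerivAt.comp (G := E →L[ℝ] E [⋀^Fin k]→L[ℝ] ℝ) y hL hβ.hasFDerivAt
  exact HasFDerivAt.clm_apply (H := E [⋀^Fin k]→L[ℝ] ℝ) hc hV.hasFDerivAt

lemma fderiv_curryLeft_apply {V : E → E} {β : E → E [⋀^Fin (k + 1)]→L[ℝ] ℝ} {y : E}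
    (hβ : DifferentiableAt ℝ β y) (hV : DifferentiableAt ℝ V y) (w : E) :
    fderiv ℝ (fun z => (β z).curryLeft (V z)) y w =
      (β y).curryLeft (fderiv ℝ V y w) + (fderiv ℝ β y w).curryLeft (V y) := by
  rw [(hasFDerivAt_curryLeft hβ hV).fderiv]
  rfl

/-- Contracting with `u` the exterior derivative, in terms of the exterior derivative of the
contraction with `u` frozen. -/
lemma extDeriv_curryLeft (β : E → E [⋀^Fin (k + 1)]→L[ℝ] ℝ) (y u : E) :
    (extDeriv β y).curryLeft u = fderiv ℝ β y u -
      ContinuousAlternatingMap.alternatizeUncurryFin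
        ((ContinuousAlternatingMap.curryLeftLI.toContinuousLinearMap ∘L fderiv ℝ β y).flip u) := by
  ext w
  -- The summand differentiating along slot 0, which holds `u`, is the derivative along `u`. In the
  -- others the index shifts by one when `u` is frozen, hence the minus sign.
  rw [ContinuousAlternatingMap.curryLeft_apply_apply, extDeriv,
    ContinuousAlternatingMap.alternatizeUncurryFin_apply, Fin.sum_univ_succ,
    ContinuousAlternatingMap.sub_apply, ContinuousAlternatingMap.alternatizeUncurryFin_apply,
    sub_eq_add_neg, ← Finset.sum_neg_distrib]
  congr 1
  · simp
  · refine Finset.sum_congr rfl fun i _ => ?_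
    have h : i.succ.removeNth (Matrix.vecCons u w : Fin (k + 2) → E) =
        Matrix.vecCons u (i.removeNth w) := by
      ext j
      refine Fin.cases ?_ (fun j => ?_) j <;> simp [Fin.removeNth]
    rw [h]
    simp [pow_succ]

/-- Cartan's formula on a normed space, in positive degree. -/
lemma lieDerivModel_eq_add {V : E → E} {β : E → E [⋀^Fin (k + 1)]→L[ℝ] ℝ} {y : E}
    (hβ : DifferentiableAt ℝ β y) (hV : DifferentiableAt ℝ V y) :
    lieDerivModel V β y =
      extDeriv (fun z => (β z).curryLeft (V z)) y + (extDeriv β y).curryLeft (V y) := by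
  rw [extDeriv_curryLeft, extDeriv, (hasFDerivAt_curryLeft hβ hV).fderiv,
    ContinuousAlternatingMap.alternatizeUncurryFin_add, lieDerivModel,
    ContinuousAlternatingMap.fderivCompContinuousLinearMap_eq_alternatizeUncurryFin]
  -- Inserting `DV` into one slot of `β` at a time is the alternatization of `w ↦ ι_{DV w} β`, the
  -- half of `d ι_V β` in which `V` is differentiated. The other half cancels against `ι_V dβ`.
  have h : ContinuousAlternatingMap.alternatizeUncurryFin ((β y).curryLeft ∘L fderiv ℝ V y) =
      (ContinuousAlternatingMap.alternatizeUncurryFinCLM ℝ E ℝ ∘L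
        ((ContinuousAlternatingMap.compContinuousLinearMapCLM (ContinuousLinearMap.id ℝ E) ∘L
          (β y).curryLeft).postcomp E)) (fderiv ℝ V y) := by
    ext w
    simp
    rfl
  rw [← h]
  abel

/-- Cartan's formula on a normed space, in degree zero. -/
lemma lieDerivModel_zero_eq (V : E → E) (β : E → E [⋀^Fin 0]→L[ℝ] ℝ) (y : E) :
    lieDerivModel V β y = (extDeriv β y).curryLeft (V y) := by
  ext w
  simp [lieDerivModel, extDeriv, ContinuousAlternatingMap.alternatizeUncurryFin_apply]

/-- The commutator of the Lie derivative and the contraction, on a normed space. -/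
lemma lieDerivModel_curryLeft {V W : E → E} {β : E → E [⋀^Fin (k + 1)]→L[ℝ] ℝ} {y : E}
    (hβ : DifferentiableAt ℝ β y) (hW : DifferentiableAt ℝ W y) :
    lieDerivModel V (fun z => (β z).curryLeft (W z)) y =
      (lieDerivModel V β y).curryLeft (W y) +
        (β y).curryLeft (VectorField.lieBracket ℝ V W y) := by
  ext w
  -- In `(L_V β)(W, ·)`, slot 0 gives `β(DV W, ·)`, which cancels the second half of `[V, W] = DW V
  -- - DV W`; the remaining slots (`h2`) are the `DV` terms of `L_V (ι_W β)`.
  have h1 : (fun j => Function.update (fun _ : Fin (k + 1) => ContinuousLinearMap.id ℝ E) 0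
      (fderiv ℝ V y) j (Matrix.vecCons (W y) w j)) = Matrix.vecCons (fderiv ℝ V y (W y)) w := by
    ext j
    refine Fin.cases ?_ (fun j => ?_) j <;> simp [Function.update]
  have h2 (i : Fin k) : (fun j => Function.update (fun _ : Fin (k + 1) =>
      ContinuousLinearMap.id ℝ E) i.succ (fderiv ℝ V y) j (Matrix.vecCons (W y) w j)) =
      Matrix.vecCons (W y) (fun j => Function.update (fun _ : Fin k =>
        ContinuousLinearMap.id ℝ E) i (fderiv ℝ V y) j (w j)) := by
    ext j
    refine Fin.cases ?_ (fun j => ?_) j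
    · simp [Function.update_of_ne (Fin.succ_ne_zero i).symm]
    · simp [Function.update]
  simp only [lieDerivModel, fderiv_curryLeft_apply hβ hW, VectorField.lieBracket, map_sub,
    ContinuousAlternatingMap.add_apply, ContinuousAlternatingMap.sub_apply,
    ContinuousAlternatingMap.curryLeft_apply_apply,
    ContinuousAlternatingMap.fderivCompContinuousLinearMap_apply, Fin.sum_univ_succ, h1, h2]
  ring

end Model

/-! ### Contraction and vector fields in charts. -/

section Chart

variable {E : Type*} [NormedAddCommGroup E] [NormedSpace ℝ E]
  {M : Type*} [TopologicalSpace M] [ChartedSpace E M] [IsManifold 𝓘(ℝ, E) (⊤ : ℕ∞) M]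

lemma isInvertible_mfderiv_extChartAt_symm {x : M} {y : E}
    (hy : y ∈ (extChartAt 𝓘(ℝ, E) x).target) :
    (mfderiv 𝓘(ℝ, E) 𝓘(ℝ, E) (extChartAt 𝓘(ℝ, E) x).symm y).IsInvertible := by
  have : IsManifold 𝓘(ℝ, E) 1 M := .of_le (n := ((⊤ : ℕ∞) : WithTop ℕ∞)) (by simp)
  have h := isInvertible_mfderivWithin_extChartAt_symm (I := 𝓘(ℝ, E)) hy
  rwa [ModelWithCorners.range_eq_univ, mfderivWithin_univ] at h

/-- The chart expression of `V` uses the inverse of the very derivative by which forms are pulled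
back. On the chart target this derivative is invertible, so the two cancel. -/
lemma chartForm_contract (x : M) (V : VField E M) (α : Form E M) (k : ℕ) {y : E}
    (hy : y ∈ (extChartAt 𝓘(ℝ, E) x).target) :
    chartForm x (contract V α k) y =
      (chartForm x (α (k + 1)) y).curryLeft (chartField x V y) := by
  have h := (isInvertible_mfderiv_extChartAt_symm hy).self_apply_inverse
    (V ((extChartAt 𝓘(ℝ, E) x).symm y))
  refine Eq.trans ?_ (ContinuousAlternatingMap.curryLeft_compContinuousLinearMap _ _ _).symm
  change ((α (k + 1) _).curryLeft (V _)).compContinuousLinearMap _ = _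
  congr 2
  exact h.symm

lemma contDiffOn_chartField [CompleteSpace E] (x : M) {V : VField E M} (hV : V.IsSmooth) :
    ContDiffOn ℝ (⊤ : ℕ∞) (chartField x V) (extChartAt 𝓘(ℝ, E) x).target := by
  intro y hy
  refine ContDiffAt.contDiffWithinAt (contMDiffAt_vectorSpace_iff_contDiffAt.1 ?_)
  have hs : ContMDiffAt 𝓘(ℝ, E) 𝓘(ℝ, E) (⊤ : ℕ∞) (extChartAt 𝓘(ℝ, E) x).symm y :=
    (contMDiffOn_extChartAt_symm x).contMDiffAt ((isOpen_extChartAt_target x).mem_nhds hy)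
  -- Pulling back a vector field costs one derivative of the chart, which is harmless since `∞ + 1 =
  -- ∞`.
  have : IsManifold 𝓘(ℝ, E) ((((⊤ : ℕ∞) : WithTop ℕ∞)) + 1) M := by simpa using ‹_›
  exact ContMDiffAt.mpullback_vectorField_preimage (n := (⊤ : ℕ∞)) (hV _) hs
    (isInvertible_mfderiv_extChartAt_symm hy) (by simp)

lemma mfderiv_extChartAt_apply (x : M) (V : VField E M) :
    mfderiv 𝓘(ℝ, E) 𝓘(ℝ, E) (extChartAt 𝓘(ℝ, E) x) x (V x) =
      chartField x V (extChartAt 𝓘(ℝ, E) x x) := by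
  have : IsManifold 𝓘(ℝ, E) 1 M := .of_le (n := ((⊤ : ℕ∞) : WithTop ℕ∞)) (by simp)
  have hx := mem_extChartAt_source (I := 𝓘(ℝ, E)) x
  have h := mfderivWithin_extChartAt_symm_comp_mfderiv_extChartAt' (I := 𝓘(ℝ, E)) hx
  rw [ModelWithCorners.range_eq_univ, mfderivWithin_univ] at h
  have hy := mem_extChartAt_target (I := 𝓘(ℝ, E)) x
  symm
  refine ((isInvertible_mfderiv_extChartAt_symm hy).inverse_apply_eq).2 ?_
  have h1 := congrArg (fun A => A (V x)) h
  -- The pullback evaluates `V` at `φ⁻¹(φ x)`, which equals `x` only propositionally.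
  have h2 := (extChartAt 𝓘(ℝ, E) x).left_inv hx
  refine Eq.trans ?_ h1.symm
  exact congrArg (fun z => (V z : E)) h2

end Chart

/-! ### Cartan calculus on the manifold. -/

section Manifold

variable {E : Type*} [NormedAddCommGroup E] [NormedSpace ℝ E]
  {M : Type*} [TopologicalSpace M] [ChartedSpace E M]

namespace Form.IsSmooth

variable {α β : Form E M}

lemma differentiableAt (hα : α.IsSmooth) (k : ℕ) (x : M) :
    DifferentiableAt ℝ (chartForm x (α k)) (extChartAt 𝓘(ℝ, E) x x) :=
  ((hα k x).contDiffAt ((isOpen_extChartAt_target x).mem_nhds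
    (mem_extChartAt_target x))).differentiableAt (by simp)

lemma add (hα : α.IsSmooth) (hβ : β.IsSmooth) : (α + β).IsSmooth := fun k x =>
  (hα k x).add (hβ k x)

lemma smul (c : ℝ) (hα : α.IsSmooth) : (c • α).IsSmooth := fun k x =>
  (hα k x).const_smul c

variable [IsManifold 𝓘(ℝ, E) (⊤ : ℕ∞) M] [CompleteSpace E]

lemma contract {V : VField E M} (hV : V.IsSmooth) (hα : α.IsSmooth) :
    (contract V α).IsSmooth := fun k x => by
  refine ContDiffOn.congr ?_ fun y hy => chartForm_contract x V α k hy
  exact (ContinuousAlternatingMap.curryLeftLI.toContinuousLinearMap.contDiff.comp_contDiffOn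
    (hα (k + 1) x)).clm_apply (contDiffOn_chartField x hV)

end Form.IsSmooth

variable {α β : Form E M}

lemma d_add (hα : α.IsSmooth) (hβ : β.IsSmooth) : d (α + β) = d α + d β := by
  funext k x
  cases k with
  | zero => exact (add_zero _).symm
  | succ k =>
    change pullChart x (extDeriv (chartForm x (α k) + chartForm x (β k))) = _
    rw [pullChart, extDeriv_add (hα.differentiableAt k x) (hβ.differentiableAt k x)]
    rfl

lemma d_smul (c : ℝ) (α : Form E M) : d (c • α) = c • d α := by
  funext k x
  cases k with
  | zero => exact (smul_zero c).symm
  | succ k =>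
    change pullChart x (extDeriv (c • chartForm x (α k))) = _
    rw [pullChart, extDeriv_smul]
    rfl

lemma d_zero : d (0 : Form E M) = 0 := by
  simpa using d_smul 0 (0 : Form E M)

/-- Polarization: contracting twice with `V + W` gives zero, and only the mixed terms survive. -/
lemma contract_contract_comm (V W : VField E M) (α : Form E M) :
    contract V (contract W α) = - contract W (contract V α) := by
  rw [eq_neg_iff_add_eq_zero]
  funext k x
  have h (V W : E) : ((α (k + 2) x).curryLeft W).curryLeft V +
      ((α (k + 2) x).curryLeft V).curryLeft W = 0 := by
    have h' := (α (k + 2) x).curryLeft_same (V + W)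
    rw [map_add (α (k + 2) x).curryLeft, ContinuousAlternatingMap.curryLeft_add, add_apply,
      map_add, map_add, ContinuousAlternatingMap.curryLeft_same,
      ContinuousAlternatingMap.curryLeft_same, zero_add, add_zero, add_comm] at h'
    exact h'
  exact h (V x) (W x)

variable [IsManifold 𝓘(ℝ, E) (⊤ : ℕ∞) M]

/-- Together with `chartForm_contract`, this carries contractions through both halves of the chart
definitions of `d` and `lieDeriv`, so that identities on `E` transfer to `M`. -/
lemma pullChart_curryLeft {k : ℕ} (x : M) (V : VField E M) (β : E → E [⋀^Fin (k + 1)]→L[ℝ] ℝ) :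
    (pullChart x β).curryLeft (V x) =
      pullChart x (fun y => (β y).curryLeft (chartField x V y)) := by
  refine (ContinuousAlternatingMap.curryLeft_compContinuousLinearMap _ _ _).trans ?_
  rw [pullChart, ← mfderiv_extChartAt_apply]
  rfl

/-- Agreement near the centre, not just at it, is what allows differentiation. -/
lemma chartForm_contract_eventuallyEq (x : M) (V : VField E M) (α : Form E M) (k : ℕ) :
    chartForm x (contract V α k) =ᶠ[nhds (extChartAt 𝓘(ℝ, E) x x)]
      fun y => (chartForm x (α (k + 1)) y).curryLeft (chartField x V y) :=
  Filter.eventually_of_mem ((isOpen_extChartAt_target x).mem_nhds (mem_extChartAt_target x))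
    fun _ hy => chartForm_contract x V α k hy

/-- The identity `α = φ^* φ_* α` at the centre `x` of the chart `φ`. -/
lemma pullChart_chartForm {k : ℕ} (x : M) (α : M → E [⋀^Fin k]→L[ℝ] ℝ) :
    pullChart x (chartForm x α) = α x := by
  have : IsManifold 𝓘(ℝ, E) 1 M := .of_le (n := ((⊤ : ℕ∞) : WithTop ℕ∞)) (by simp)
  have hx := mem_extChartAt_source (I := 𝓘(ℝ, E)) x
  have h := mfderivWithin_extChartAt_symm_comp_mfderiv_extChartAt' (I := 𝓘(ℝ, E)) hx
  rw [ModelWithCorners.range_eq_univ, mfderivWithin_univ] at h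
  ext w
  refine Eq.trans ?_ (DFunLike.congr_fun (congrArg α ((extChartAt 𝓘(ℝ, E) x).left_inv hx)) w)
  exact congrArg (α _) (funext fun i => congrArg (fun A => A (w i)) h)

lemma chartField_differentiableAt [CompleteSpace E] (x : M) {V : VField E M} (hV : V.IsSmooth) :
    DifferentiableAt ℝ (chartField x V) (extChartAt 𝓘(ℝ, E) x x) :=
  ((contDiffOn_chartField x hV).contDiffAt ((isOpen_extChartAt_target x).mem_nhds
    (mem_extChartAt_target x))).differentiableAt (by simp)

/-- Cartan's formula `L_V = d ι_V + ι_V d`. -/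
theorem lieDeriv_eq_d_contract_add [CompleteSpace E] {V : VField E M} (hV : V.IsSmooth)
    (hα : α.IsSmooth) : lieDeriv V α = d (contract V α) + contract V (d α) := by
  funext k x
  have h : contract V (d α) k x = pullChart x fun y =>
      (extDeriv (chartForm x (α k)) y).curryLeft (chartField x V y) :=
    pullChart_curryLeft x V _
  refine Eq.trans ?_ (congrArg (d (contract V α) k x + ·) h.symm)
  -- In degree zero `d` is zero by definition, so only `ι_V d` contributes.
  cases k with
  | zero =>
    refine Eq.trans ?_ (zero_add _).symm
    rw [lieDeriv, pullChart, lieDerivModel_zero_eq]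
    rfl
  | succ k =>
    rw [lieDeriv, pullChart, lieDerivModel_eq_add (hα.differentiableAt _ x)
      (chartField_differentiableAt x hV)]
    have h' : d (contract V α) (k + 1) x = pullChart x
        (extDeriv fun y => (chartForm x (α (k + 1)) y).curryLeft (chartField x V y)) := by
      change pullChart x (extDeriv (chartForm x (contract V α k))) = _
      rw [pullChart, (chartForm_contract_eventuallyEq x V α k).extDeriv_eq]
      rfl
    rw [h']
    rfl

/-- At `x`, `mlieBracket` is by definition the bracket in the preferred chart at `x`, carried back
to `M`; at the centre no change of chart intervenes. -/
lemma chartField_mlieBracket (x : M) (V W : VField E M) :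
    chartField x (VectorField.mlieBracket 𝓘(ℝ, E) V W) (extChartAt 𝓘(ℝ, E) x x) =
      VectorField.lieBracket ℝ (chartField x V) (chartField x W) (extChartAt 𝓘(ℝ, E) x x) := by
  have : IsManifold 𝓘(ℝ, E) 1 M := .of_le (n := ((⊤ : ℕ∞) : WithTop ℕ∞)) (by simp)
  rw [← mfderiv_extChartAt_apply]
  refine ((isInvertible_mfderiv_extChartAt
    (mem_extChartAt_source (I := 𝓘(ℝ, E)) x)).self_apply_inverse _).trans ?_
  simp only [ModelWithCorners.range_eq_univ, Set.preimage_univ, Set.univ_inter,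
    VectorField.mpullbackWithin_univ]
  exact congrFun (VectorField.lieBracketWithin_univ (𝕜 := ℝ) (E := E)) _

lemma lieDerivModel_congr {k : ℕ} {V : E → E} {β γ : E → E [⋀^Fin k]→L[ℝ] ℝ} {y : E}
    (h : β =ᶠ[nhds y] γ) : lieDerivModel V β y = lieDerivModel V γ y := by
  rw [lieDerivModel, lieDerivModel, h.fderiv_eq, h.eq_of_nhds]

/-- The commutator `[L_V, ι_W] = ι_[V, W]`. -/
theorem lieDeriv_contract [CompleteSpace E] {V W : VField E M} (hW : W.IsSmooth)
    (hα : α.IsSmooth) :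
    lieDeriv V (contract W α) =
      contract W (lieDeriv V α) + contract (VectorField.mlieBracket 𝓘(ℝ, E) V W) α := by
  funext k x
  have h1 : contract W (lieDeriv V α) k x = pullChart x fun y =>
      (lieDerivModel (chartField x V) (chartForm x (α (k + 1))) y).curryLeft (chartField x W y) :=
    pullChart_curryLeft x W _
  have h2 : contract (VectorField.mlieBracket 𝓘(ℝ, E) V W) α k x = pullChart x fun y =>
      (chartForm x (α (k + 1)) y).curryLeft
        (VectorField.lieBracket ℝ (chartField x V) (chartField x W) y) := by
    rw [pullChart, ← chartField_mlieBracket]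
    refine Eq.trans ?_ (pullChart_curryLeft x (VectorField.mlieBracket 𝓘(ℝ, E) V W) _)
    rw [pullChart_chartForm]
    rfl
  refine Eq.trans ?_ (congrArg₂ (· + ·) h1 h2).symm
  rw [lieDeriv, pullChart, lieDerivModel_congr (chartForm_contract_eventuallyEq x W α k),
    lieDerivModel_curryLeft (hα.differentiableAt _ x) (chartField_differentiableAt x hW)]
  rfl

end Manifold
-- Contraction with multivectors and the homology differential.
section Algebra

open ExteriorAlgebra

variable {E : Type*} [NormedAddCommGroup E] [NormedSpace ℝ E]
  {M : Type*} [TopologicalSpace M] [ChartedSpace E M]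
  {𝔤 : Type*} [LieRing 𝔤] [LieAlgebra ℝ 𝔤]

section

variable (v : 𝔤 →ₗ[ℝ] VField E M) (α : Form E M)

lemma contractMulti_zero : contractMulti v 0 α = 0 := by
  simp [contractMulti]

lemma contractMulti_one : contractMulti v 1 α = α := by
  simp [contractMulti]

lemma contractMulti_add (p q : ExteriorAlgebra ℝ 𝔤) :
    contractMulti v (p + q) α = contractMulti v p α + contractMulti v q α := by
  simp [contractMulti]

lemma contractMulti_neg (p : ExteriorAlgebra ℝ 𝔤) :
    contractMulti v (-p) α = - contractMulti v p α := by
  simp [contractMulti]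

lemma contractMulti_sub (p q : ExteriorAlgebra ℝ 𝔤) :
    contractMulti v (p - q) α = contractMulti v p α - contractMulti v q α := by
  simp [contractMulti]

lemma contractMulti_smul (c : ℝ) (p : ExteriorAlgebra ℝ 𝔤) :
    contractMulti v (c • p) α = c • contractMulti v p α := by
  simp [contractMulti]

lemma contractMulti_algebraMap (c : ℝ) :
    contractMulti v (algebraMap ℝ _ c) α = c • α := by
  rw [Algebra.algebraMap_eq_smul_one, contractMulti_smul, contractMulti_one]

lemma contractMulti_ι_mul (x : 𝔤) (q : ExteriorAlgebra ℝ 𝔤) :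
    contractMulti v (ι ℝ x * q) α = contractMulti v q (contract (v x) α) := by
  rw [contractMulti, map_mul, lift_ι_apply]
  rfl

/-- Induction on the degree: a property of elements of `Λ^k 𝔤` that is additive and homogeneous
holds if it is inherited by `x ∧ q` from `q`. -/
lemma exteriorPower_induction {P : ℕ → ExteriorAlgebra ℝ 𝔤 → Prop}
    (one : P 0 1) (ι_mul : ∀ k x q, q ∈ ⋀[ℝ]^k 𝔤 → P k q → P (k + 1) (ι ℝ x * q))
    (zero : ∀ k, P k 0) (add : ∀ k p q, P k p → P k q → P k (p + q))
    (smul : ∀ k (c : ℝ) p, P k p → P k (c • p)) {k : ℕ} {p : ExteriorAlgebra ℝ 𝔤}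
    (hp : p ∈ ⋀[ℝ]^k 𝔤) : P k p := by
  rw [← ιMulti_span_fixedDegree] at hp
  induction hp using Submodule.span_induction with
  | zero => exact zero k
  | add p q _ _ hp hq => exact add k p q hp hq
  | smul c p _ hp => exact smul k c p hp
  | mem p hp =>
    obtain ⟨x, rfl⟩ := hp
    induction k with
    | zero => rwa [ιMulti_zero_apply]
    | succ k ih =>
      rw [ιMulti_succ_apply]
      exact ι_mul k _ _ (ιMulti_range ℝ k ⟨_, rfl⟩) (ih _)

lemma contract_contractMulti (W : VField E M) {k : ℕ} {q : ExteriorAlgebra ℝ 𝔤}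
    (hq : q ∈ ⋀[ℝ]^k 𝔤) (α : Form E M) :
    contract W (contractMulti v q α) = (-1 : ℝ) ^ k • contractMulti v q (contract W α) := by
  -- `ι(v_{x ∧ q})` applies `ι_{v_x}` first, so the induction hypothesis for `q` is needed at
  -- `ι_{v_x}α`.
  revert α
  refine exteriorPower_induction (P := fun k q => ∀ α : Form E M,
    contract W (contractMulti v q α) = (-1 : ℝ) ^ k • contractMulti v q (contract W α))
    ?_ ?_ ?_ ?_ ?_ hq
  · simp [contractMulti_one]
  · intro k x q _ ih α
    rw [contractMulti_ι_mul, contractMulti_ι_mul, ih, contract_contract_comm, map_neg, pow_succ]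
    module
  · simp [contractMulti_zero]
  · intro k p q hp hq α
    rw [contractMulti_add, contractMulti_add, map_add, hp, hq, smul_add]
  · intro k c p hp α
    rw [contractMulti_smul, contractMulti_smul, map_smul, hp, smul_comm]

/-- Makes `ι_{v_x}` the outermost contraction, where Cartan's formula for `v_x` applies. -/
lemma contractMulti_ι_mul_eq_contract (x : 𝔤) {k : ℕ} {q : ExteriorAlgebra ℝ 𝔤}
    (hq : q ∈ ⋀[ℝ]^k 𝔤) :
    contractMulti v (ι ℝ x * q) α = (-1 : ℝ) ^ k • contract (v x) (contractMulti v q α) := by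
  rw [contractMulti_ι_mul, contract_contractMulti v _ hq, smul_smul, ← mul_pow]
  simp

end

variable [IsManifold 𝓘(ℝ, E) (⊤ : ℕ∞) M] [CompleteSpace E] {v : 𝔤 →ₗ[ℝ] VField E M}

lemma Form.IsSmooth.contractMulti (hv : ∀ x, (v x).IsSmooth) {α : Form E M} (hα : α.IsSmooth)
    (p : ExteriorAlgebra ℝ 𝔤) : (contractMulti v p α).IsSmooth := by
  induction p using CliffordAlgebra.left_induction generalizing α with
  | algebraMap c =>
    have := contractMulti_algebraMap v α c
    exact this ▸ hα.smul c
  | add p q hp hq => exact contractMulti_add v α p q ▸ (hp hα).add (hq hα)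
  | ι_mul q x hq => exact contractMulti_ι_mul v α x q ▸ hq (hα.contract (hv x))

lemma lieDeriv_add {V : VField E M} (hV : V.IsSmooth) {α β : Form E M} (hα : α.IsSmooth)
    (hβ : β.IsSmooth) : lieDeriv V (α + β) = lieDeriv V α + lieDeriv V β := by
  rw [lieDeriv_eq_d_contract_add hV (hα.add hβ), lieDeriv_eq_d_contract_add hV hα,
    lieDeriv_eq_d_contract_add hV hβ, d_add hα hβ, map_add, map_add,
    d_add (hα.contract hV) (hβ.contract hV)]
  abel

lemma lieDeriv_smul {V : VField E M} (hV : V.IsSmooth) (c : ℝ) {α : Form E M}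
    (hα : α.IsSmooth) : lieDeriv V (c • α) = c • lieDeriv V α := by
  rw [lieDeriv_eq_d_contract_add hV (hα.smul c), lieDeriv_eq_d_contract_add hV hα, map_smul,
    d_smul, d_smul, map_smul, smul_add]

/-- `L_{v_x} ι(v_q) = ι(v_q) L_{v_x} + ι(v_[x, q])`. -/
lemma lieDeriv_contractMulti (hv : ∀ x, (v x).IsSmooth)
    (hlie : ∀ x y, v ⁅x, y⁆ = VectorField.mlieBracket 𝓘(ℝ, E) (v x) (v y)) (x : 𝔤)
    {α : Form E M} (hα : α.IsSmooth) (q : ExteriorAlgebra ℝ 𝔤) :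
    lieDeriv (v x) (contractMulti v q α) =
      contractMulti v q (lieDeriv (v x) α) + contractMulti v (adExt 𝔤 q x) α := by
  induction q using CliffordAlgebra.left_induction generalizing α with
  | algebraMap c =>
    change lieDeriv (v x) (contractMulti v (algebraMap ℝ (ExteriorAlgebra ℝ 𝔤) c) α) =
      contractMulti v (algebraMap ℝ (ExteriorAlgebra ℝ 𝔤) c) (lieDeriv (v x) α) +
        contractMulti v (adExt 𝔤 (algebraMap ℝ (ExteriorAlgebra ℝ 𝔤) c) x) α
    rw [contractMulti_algebraMap, contractMulti_algebraMap, lieDeriv_smul (hv x) c hα,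
      Algebra.algebraMap_eq_smul_one, map_smul, LinearMap.smul_apply, adExt_one, smul_zero,
      contractMulti_zero, add_zero]
  | add p q hp hq =>
    rw [contractMulti_add, lieDeriv_add (hv x) (hα.contractMulti hv p) (hα.contractMulti hv q),
      hp hα, hq hα, map_add, LinearMap.add_apply, contractMulti_add, contractMulti_add]
    abel
  | ι_mul q y hq =>
    change lieDeriv (v x) (contractMulti v (ι ℝ y * q) α) =
      contractMulti v (ι ℝ y * q) (lieDeriv (v x) α) +
        contractMulti v (adExt 𝔤 (ι ℝ y * q) x) α
    -- The commutator `[L_{v_x}, ι_{v_y}] = ι_{v_[x,y]}` supplies the `[x, y] ∧ q` term of the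
    -- derivation rule.
    rw [contractMulti_ι_mul, hq (hα.contract (hv y)), lieDeriv_contract (hv y) hα, ← hlie, map_add,
      adExt_ι_mul, contractMulti_add, contractMulti_ι_mul, contractMulti_ι_mul, contractMulti_ι_mul]
    abel

/-- For a form `α` preserved by the action and `p ∈ Λ^k 𝔤`,
`d ι(v_p) α = (-1)^k (ι(v_p) dα + ι(v_∂p) α)`. -/
theorem d_contractMulti (hv : ∀ x, (v x).IsSmooth)
    (hlie : ∀ x y, v ⁅x, y⁆ = VectorField.mlieBracket 𝓘(ℝ, E) (v x) (v y))
    {α : Form E M} (hα : α.IsSmooth) (hpres : IsStrictlyPreserving v α)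
    {k : ℕ} {p : ExteriorAlgebra ℝ 𝔤} (hp : p ∈ ⋀[ℝ]^k 𝔤) :
    d (contractMulti v p α) =
      (-1 : ℝ) ^ k • (contractMulti v p (d α) + contractMulti v (lieDiff 𝔤 p) α) := by
  refine exteriorPower_induction (P := fun k p => d (contractMulti v p α) =
    (-1 : ℝ) ^ k • (contractMulti v p (d α) + contractMulti v (lieDiff 𝔤 p) α)) ?_ ?_ ?_ ?_ ?_ hp
  · simp [contractMulti_one, lieDiff_one, contractMulti_zero]
  · intro k x q hq ih
    -- After the rewriting this expresses `d ι_{v_x} ι(v_q)α` as `ι(v_[x,q])α` minus `ι_{v_x}` of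
    -- the inductive formula for `d ι(v_q)α`.
    have hc := lieDeriv_eq_d_contract_add (hv x) (hα.contractMulti hv q)
    rw [lieDeriv_contractMulti hv hlie x hα, hpres x, map_zero, zero_add, ih, ← sub_eq_iff_eq_add]
      at hc
    have hb : contractMulti v (ι ℝ x * lieDiff 𝔤 q) α =
        -((-1 : ℝ) ^ k • contract (v x) (contractMulti v (lieDiff 𝔤 q) α)) := by
      -- Since `∂q` has degree `k - 1`, the sign is `(-1)^(k-1) = -(-1)^k`. For `k = 0` truncated
      -- subtraction would give the wrong sign, but then `q` is a scalar and `∂q = 0`.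
      cases k with
      | zero =>
        have h0 : lieDiff 𝔤 q = 0 := by
          rw [exteriorPower, pow_zero, Submodule.mem_one] at hq
          obtain ⟨c, rfl⟩ := hq
          rw [Algebra.algebraMap_eq_smul_one, map_smul, lieDiff_one, smul_zero]
        simp [h0, contractMulti_zero]
      | succ k =>
        rw [contractMulti_ι_mul_eq_contract v α x (lieDiff_mem 𝔤 (k + 1) hq), pow_succ, Nat.add_sub_cancel]
        module
    rw [contractMulti_ι_mul_eq_contract v α x hq, d_smul, ← hc, lieDiff_ι_mul, contractMulti_sub,
      contractMulti_neg, hb, contractMulti_ι_mul_eq_contract v (d α) x hq, pow_succ]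
    rw [map_smul, map_add]
    rcases neg_one_pow_eq_or ℝ k with hs | hs <;> rw [hs] <;> module
  · simp [contractMulti_zero, d_zero]
  · intro k p q hp hq
    rw [contractMulti_add, d_add (hα.contractMulti hv p) (hα.contractMulti hv q), hp, hq,
      contractMulti_add, map_add, contractMulti_add, ← smul_add]
    congr 1
    abel
  · intro k c p hp
    rw [contractMulti_smul, d_smul, hp, contractMulti_smul, map_smul, contractMulti_smul,
      ← smul_add, smul_comm]

end Algebra

end Multisymplectic

/-! ### The conservation law. -/

open Multisymplectic in
theorem mainTheorem1
    {E : Type*} [NormedAddCommGroup E] [NormedSpace ℝ E] [FiniteDimensional ℝ E]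
    {M : Type*} [TopologicalSpace M] [ChartedSpace E M] [IsManifold 𝓘(ℝ, E) (⊤ : ℕ∞) M]
    {𝔤 : Type*} [LieRing 𝔤] [LieAlgebra ℝ 𝔤]
    (n : ℕ) (ω : Form E M) (hω : IsPrePlectic n ω)
    (H : Form E M) (hH : IsHamiltonianForm n ω H)
    (vH : VField E M) (hvH : IsHamiltonianField ω H vH)
    (v : 𝔤 →ₗ[ℝ] VField E M) (hv : IsMultisymplecticAction ω v)
    (hvH_pres : IsStrictlyPreserving v H)
    (f : ∀ k : ℕ, ⋀[ℝ]^k 𝔤 →ₗ[ℝ] Form E M) (hf : IsComomentumMap n ω v f)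
    (k : ℕ) (hk : 1 ≤ k) (hkn : k ≤ n) (p : ⋀[ℝ]^k 𝔤) (hp : p ∈ lieCycles 𝔤 k) :
    IsGloballyConserved vH (f k p) ∧
      lieDeriv vH (f k p) =
        d (contract vH (f k p) + varsigma k • contractMulti v p H) := by
  -- Finite dimension serves to give completeness, needed for smooth vector fields to be smooth in
  -- charts.
  have : CompleteSpace E := FiniteDimensional.complete ℝ E
  have hfs := (hf.form k hk hkn p).smooth
  have hHs := hH.form.smooth
  have hι := hfs.contract hvH.smooth
  have hpH : (varsigma k • contractMulti v (p : ExteriorAlgebra ℝ 𝔤) H).IsSmooth :=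
    (hHs.contractMulti hv.smooth p).smul _
  have hp0 : lieBoundary 𝔤 k p = 0 := hp
  have hp' : lieDiff 𝔤 p = 0 := congrArg Subtype.val hp0
  have hdf : d (f k p) = -(varsigma k • contractMulti v (p : ExteriorAlgebra ℝ 𝔤) ω) := by
    have h := hf.eq k hk (by omega) p
    rw [hp0, map_zero, neg_zero] at h
    exact eq_neg_of_add_eq_zero_left h.symm
  have key : lieDeriv vH (f k p) =
      d (contract vH (f k p) + varsigma k • contractMulti v p H) := by
    -- Apart from `d ι_{vH} f_k(p)`, both sides become `-ς(k)(-1)^k ι(v_p) ι_{vH} ω`; the value of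
    -- `ς(k)` plays no role.
    rw [d_add hι hpH, d_smul, lieDeriv_eq_d_contract_add hvH.smooth hfs, hdf,
      d_contractMulti hv.smooth hv.map_lie hHs hvH_pres p.2, hp', contractMulti_zero, add_zero,
      hvH.eq, map_neg, map_neg, map_smul, contract_contractMulti v vH p.2, smul_neg, smul_neg]
  exact ⟨⟨_, hι.add hpH, key⟩, key⟩
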